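/- Let $d$ be a natural number, let $E_1,\dots,E_d\in\mathbb R$ be energy levels, let $\beta\in\mathbb R$ be an inverse temperature, and let $\gamma_i=e^{-\beta E_i}/\sum_j e^{-\beta E_j}$ be the Gibbs distribution. Let $p=(p_1,\dots,p_d)$ be a probability vector. The future thermal cone $\mathcal T_+^\beta(p)$ of $p$ is the set of all vectors $\Lambda p$, where $\Lambda$ is a $d\times d$ column-stochastic matrix (nonnegative entries, columns summing to $1$) with $\Lambda\gamma=\gamma$. Choose a permutation $\pi_p$ with $p_{\pi_p^{-1}(i)}/\gamma_{\pi_p^{-1}(i)}$ non-increasing in $i$. The thermomajorisation curve $f_p^\beta:[0,1]\to[0,1]$ is the piecewise linear curve through $(0,0)$ and the points $\left(\sum_{i=1}^k\gamma_{\pi_p^{-1}(i)},\ \sum_{i=1}^k p_{\pi_p^{-1}(i)}\right)$, $k=1,\dots,d$. For $\pi\in\mathcal S_d$ put $x_i^\pi=\sum_{j=1}^i\gamma_{\pi^{-1}(j)}$ and $y_i^\pi=f_p^\beta(x_i^\pi)$ for $0\le i\le d$ (so $x_0^\pi=y_0^\pi=0$), and define the vector $p^\pi$ by $p_i^\pi=y^\pi_{\pi(i)}-y^\pi_{\pi(i)-1}$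 for $1\le i\le d$. Let $\Gamma_0\le\Gamma_1\le\dots\le\Gamma_{2^d-1}$ be the $2^d$ sums $\sum_{i\in I}\gamma_i$, $I\subseteq\{1,\dots,d\}$, listed with multiplicity in non-decreasing order. The embedded vector $\mathfrak M(p)\in\mathbb R^{2^d-1}$ has the entries $\mathfrak M(p)_j=f_p^\beta(\Gamma_j)-f_p^\beta(\Gamma_{j-1})$, $1\le j\le 2^d-1$. For $\pi\in\mathcal S_d$ and $0\le i\le d$ choose an index $k_\pi(i)$ with $\Gamma_{k_\pi(i)}=x_i^\pi$, and for $q\in\mathbb R^{2^d-1}$ define the projection $\mathfrak P_\pi(q)\in\mathbb R^d$ by $$\mathfrak P_\pi(q)_{\pi^{-1}(i)}=\sum_{j=k_\pi(i-1)+1}^{k_\pi(i)}q_j,\qquad 1\le i\le d.$$ Then $$\mathcal T_+^\beta(p)=\operatorname{conv}\{p^\pi:\pi\in\mathcal S_d\},$$ moreover $\mathfrak P_\pi(\mathfrak M(p))=p^\pi$ for every $\pi\in\mathcal S_d$, and equivalently $$\mathcal T_+^\beta(p)=\operatorname{conv}\{\mathfrak P_\pi(\mathfrak M(p)):\pi\in\mathcal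 S_d\}.$$ -/

import Mathlib

namespace ThermalCones

noncomputable section

/-- The Gibbs distribution `γ_i = e^{-β E_i} / Z` with `Z = ∑_j e^{-β E_j}`, of a system with
energy levels `E` at inverse temperature `β`. -/
def gibbs {d : ℕ} (β : ℝ) (E : Fin d → ℝ) : Fin d → ℝ :=
  fun i => Real.exp (-β * E i) / ∑ j, Real.exp (-β * E j)

/-- `Λ` is a Gibbs-preserving matrix for `γ`: a stochastic matrix (nonnegative entries, every
column summing to `1`) with `Λ γ = γ`. -/
def IsGibbsPreserving {d : ℕ} (γ : Fin d → ℝ) (Λ : Matrix (Fin d) (Fin d) ℝ) : Prop :=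
  Λ ∈ Matrix.colStochastic ℝ (Fin d) ∧ Λ.mulVec γ = γ

/-- The future thermal cone of `p`: all states to which `p` can be mapped by a Gibbs-preserving
matrix. -/
def futureThermalCone {d : ℕ} (γ p : Fin d → ℝ) : Set (Fin d → ℝ) :=
  {q | ∃ Λ : Matrix (Fin d) (Fin d) ℝ, IsGibbsPreserving γ Λ ∧ Λ.mulVec p = q}

/-- The sum of the first `k` entries of `v` read in the order `π`, where the permutation `π` sends
a level to its position, so that `π.symm j` is the level at position `j`
(positions are numbered from `0`). -/
def cumSum {d : ℕ} (π : Equiv.Perm (Fin d)) (v : Fin d → ℝ) (k : ℕ) : ℝ :=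
  ∑ j : Fin d with j.val < k, v (π.symm j)

/-- The `β`-order `π_p` of `p`: a permutation that sorts the ratios `p_i / γ_i`
non-increasingly. -/
def betaOrder {d : ℕ} (γ p : Fin d → ℝ) : Equiv.Perm (Fin d) :=
  (Tuple.sort fun i => -(p i / γ i)).symm

theorem betaOrder_antitone {d : ℕ} (γ p : Fin d → ℝ) :
    Antitone fun j => p ((betaOrder γ p).symm j) / γ ((betaOrder γ p).symm j) := by
  intro i j hij
  have h := Tuple.monotone_sort (fun i => -(p i / γ i)) hij
  simpa [betaOrder] using h

/-- The piecewise linear curve through `(0, 0)` and the points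
`(cumSum π γ k, cumSum π p k)`, `1 ≤ k ≤ d`, evaluated at `x`: the segment of index `k`, of width
`γ (π.symm k)`, contributes its height `p (π.symm k)` times the fraction of the segment that lies
to the left of `x`. -/
def piecewiseCurve {d : ℕ} (γ p : Fin d → ℝ) (π : Equiv.Perm (Fin d)) (x : ℝ) : ℝ :=
  ∑ k : Fin d, p (π.symm k) *
    max 0 (min 1 ((x - cumSum π γ k.val) / γ (π.symm k)))

/-- The thermomajorisation curve `f_p^β` of `p`: the piecewise linear curve whose elbows are the
consecutive subsums of the `β`-ordered vectors `p` and `γ`. -/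
def thermoCurve {d : ℕ} (γ p : Fin d → ℝ) (x : ℝ) : ℝ :=
  piecewiseCurve γ p (betaOrder γ p) x

theorem cumSum_mono {d : ℕ} (π : Equiv.Perm (Fin d)) {γ : Fin d → ℝ} (hγ : ∀ i, 0 < γ i)
    {k l : ℕ} (h : k ≤ l) : cumSum π γ k ≤ cumSum π γ l := by
  refine Finset.sum_le_sum_of_subset_of_nonneg ?_ fun i _ _ => (hγ _).le
  intro j hj
  simp only [Finset.mem_filter, Finset.mem_univ, true_and] at hj ⊢
  omega

theorem cumSum_succ {d : ℕ} (π : Equiv.Perm (Fin d)) (v : Fin d → ℝ) (k : Fin d) :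
    cumSum π v (k.val + 1) = cumSum π v k.val + v (π.symm k) := by
  have h : (Finset.univ.filter fun j : Fin d => j.val < k.val + 1)
      = insert k (Finset.univ.filter fun j : Fin d => j.val < k.val) := by
    ext j
    simp only [Finset.mem_filter, Finset.mem_univ, true_and, Finset.mem_insert, Fin.ext_iff]
    omega
  rw [cumSum, h, Finset.sum_insert (by simp), cumSum, add_comm]

/-- On each segment the curve is the affine function joining the two consecutive elbows. -/
theorem piecewiseCurve_segment {d : ℕ} (γ p : Fin d → ℝ) (hγ : ∀ i, 0 < γ i)
    (π : Equiv.Perm (Fin d)) (k : Fin d) (t : ℝ) (h0 : 0 ≤ t) (h1 : t ≤ 1) :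
    piecewiseCurve γ p π ((1 - t) * cumSum π γ k.val + t * cumSum π γ (k.val + 1)) =
      (1 - t) * cumSum π p k.val + t * cumSum π p (k.val + 1) := by
  rw [cumSum_succ, cumSum_succ]
  have e1 : (1 - t) * cumSum π γ k.val + t * (cumSum π γ k.val + γ (π.symm k))
      = cumSum π γ k.val + t * γ (π.symm k) := by ring
  have e2 : (1 - t) * cumSum π p k.val + t * (cumSum π p k.val + p (π.symm k))
      = cumSum π p k.val + t * p (π.symm k) := by ring
  rw [e1, e2, piecewiseCurve]
  have key : ∀ j : Fin d, p (π.symm j) * max 0 (min 1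
      ((cumSum π γ k.val + t * γ (π.symm k) - cumSum π γ j.val) / γ (π.symm j)))
      = (if j.val < k.val then p (π.symm j) else 0)
        + (if j = k then t * p (π.symm j) else 0) := by
    intro j
    have hj := hγ (π.symm j)
    have hk := hγ (π.symm k)
    have htk : 0 ≤ t * γ (π.symm k) := by positivity
    rcases lt_trichotomy j.val k.val with h | h | h
    · have hm := cumSum_mono π hγ (show j.val + 1 ≤ k.val by omega)
      rw [cumSum_succ] at hm
      have : 1 ≤ (cumSum π γ k.val + t * γ (π.symm k) - cumSum π γ j.val) / γ (π.symm j) := by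
        rw [le_div_iff₀ hj]; linarith
      have hne : j ≠ k := fun e => by simp [e] at h
      simp [min_eq_left this, h, hne]
    · have e : j = k := Fin.ext h
      subst e
      have : (cumSum π γ j.val + t * γ (π.symm j) - cumSum π γ j.val) / γ (π.symm j) = t := by
        field_simp; ring
      rw [this, min_eq_right h1, max_eq_right h0]
      simp [mul_comm]
    · have hm := cumSum_mono π hγ (show k.val + 1 ≤ j.val by omega)
      rw [cumSum_succ] at hm
      have : (cumSum π γ k.val + t * γ (π.symm k) - cumSum π γ j.val) / γ (π.symm j) ≤ 0 := by
        apply div_nonpos_of_nonpos_of_nonneg _ hj.le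
        nlinarith
      have hne : j ≠ k := fun e => by simp [e] at h
      have hnl : ¬ j.val < k.val := by omega
      simp [max_eq_left ((min_le_right _ _).trans this), hnl, hne]
  rw [Finset.sum_congr rfl fun j _ => key j, Finset.sum_add_distrib]
  simp [cumSum, Finset.sum_filter]

/-- The state `p^π` obtained by reading the thermomajorisation curve of `p` at the cumulative
Gibbs sums in the order `π`: with `x_i = γ_{π⁻¹(1)} + ⋯ + γ_{π⁻¹(i)}` and `y_i = f_p^β(x_i)`,
the entry of level `i` is `y_{π(i)} - y_{π(i)-1}`. -/
def orderedReading {d : ℕ} (γ p : Fin d → ℝ) (π : Equiv.Perm (Fin d)) : Fin d → ℝ :=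
  fun i => thermoCurve γ p (cumSum π γ ((π i).val + 1)) -
    thermoCurve γ p (cumSum π γ (π i).val)

/-- A numbering, in arbitrary order, of the `2 ^ d` sets of levels. -/
def subsetEquiv (d : ℕ) : Fin (2 ^ d) ≃ Finset (Fin d) :=
  (Fintype.equivFinOfCardEq (by simp)).symm

/-- The vector `Γ^𝔐` of the `2 ^ d` partial sums `∑_{i ∈ I} γ_i` over all sets `I` of levels,
counted with multiplicity and sorted non-decreasingly (indices `0, …, 2 ^ d - 1`). -/
def partialSums {d : ℕ} (γ : Fin d → ℝ) : Fin (2 ^ d) → ℝ :=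
  (fun k => ∑ i ∈ subsetEquiv d k, γ i) ∘
    Tuple.sort (fun k => ∑ i ∈ subsetEquiv d k, γ i)

theorem partialSums_monotone {d : ℕ} (γ : Fin d → ℝ) : Monotone (partialSums γ) :=
  Tuple.monotone_sort _

theorem exists_partialSums_eq {d : ℕ} (γ : Fin d → ℝ) (I : Finset (Fin d)) :
    ∃ k, partialSums γ k = ∑ i ∈ I, γ i :=
  ⟨(Tuple.sort fun k => ∑ i ∈ subsetEquiv d k, γ i).symm ((subsetEquiv d).symm I), by
    simp [partialSums]⟩

/-- The embedded vector `𝔐(p)`, with the `2 ^ d - 1` entries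
`f_p^β(Γ_j) - f_p^β(Γ_{j-1})`, `1 ≤ j ≤ 2 ^ d - 1`; the `j`-th one has index `j - 1` here. -/
def embedding {d : ℕ} (γ p : Fin d → ℝ) : Fin (2 ^ d - 1) → ℝ :=
  fun j => thermoCurve γ p (partialSums γ ⟨j.val + 1, by have := j.isLt; omega⟩) -
    thermoCurve γ p (partialSums γ ⟨j.val, by have := j.isLt; omega⟩)

theorem exists_elbowIndex {d : ℕ} (γ : Fin d → ℝ) (π : Equiv.Perm (Fin d)) (i : ℕ) :
    ∃ k, partialSums γ k = cumSum π γ i := by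
  obtain ⟨k, hk⟩ := exists_partialSums_eq γ
    ((Finset.univ.filter fun j : Fin d => j.val < i).map π.symm.toEmbedding)
  exact ⟨k, by rw [hk, Finset.sum_map]; rfl⟩

/-- An index `k(i)` with `Γ_{k(i)} = γ_{π⁻¹(1)} + ⋯ + γ_{π⁻¹(i)}`. If several partial sums
coincide there is a choice; the entries of an embedded vector between two such indices vanish. -/
def elbowIndex {d : ℕ} (γ : Fin d → ℝ) (π : Equiv.Perm (Fin d)) (i : ℕ) : Fin (2 ^ d) :=
  Classical.choose (exists_elbowIndex γ π i)

theorem partialSums_elbowIndex {d : ℕ} (γ : Fin d → ℝ) (π : Equiv.Perm (Fin d)) (i : ℕ) :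
    partialSums γ (elbowIndex γ π i) = cumSum π γ i :=
  Classical.choose_spec (exists_elbowIndex γ π i)

/-- The projection `𝔓_π` of a vector of the embedding space onto the order `π`: the entry at
position `i` of the order `π` (the level `π⁻¹(i)`) is `∑_{j = k(i-1)+1}^{k(i)} q_j`. -/
def projection {d : ℕ} (γ : Fin d → ℝ) (π : Equiv.Perm (Fin d)) (q : Fin (2 ^ d - 1) → ℝ) :
    Fin d → ℝ :=
  fun l => ∑ j : Fin (2 ^ d - 1) with
    (elbowIndex γ π (π l).val).val ≤ j.val ∧ j.val < (elbowIndex γ π ((π l).val + 1)).val, q j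

end

end ThermalCones

namespace ThermalCones

section

variable {d : ℕ}

/-! The curve at `x` is the optimum of a fractional knapsack: the largest `p`-mass of weights in
`[0, 1]` with `γ`-mass `x`, reached by filling levels greedily in the `β`-order
(`sum_mul_le_thermoCurve`). Rows of a Gibbs-preserving matrix, summed over a set of levels, are such
weights, so the partial sums of every reachable `q` lie below the curve. If `q` were outside the
hull, a linear functional would separate it; for the order `π` that sorts the coefficients of this
functional, Abel summation shows that its value at `p^π` is at least its value at `q`, a
contradiction. Conversely, an explicit matrix of interval overlaps sends `p` to `p^π`, and the cone
is convex. The projection identity is a telescoping sum. -/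

theorem gibbs_pos (β : ℝ) (E : Fin d → ℝ) (i : Fin d) : 0 < gibbs β E i := by
  unfold gibbs
  exact div_pos (Real.exp_pos _)
    (Finset.sum_pos (fun j _ => Real.exp_pos _) ⟨i, Finset.mem_univ i⟩)

theorem cumSum_zero (π : Equiv.Perm (Fin d)) (v : Fin d → ℝ) : cumSum π v 0 = 0 := by
  simp [cumSum]

theorem cumSum_card (π : Equiv.Perm (Fin d)) (v : Fin d → ℝ) : cumSum π v d = ∑ i, v i := by
  simp [cumSum, Equiv.sum_comp π.symm v]

theorem cumSum_le_sum (π : Equiv.Perm (Fin d)) {γ : Fin d → ℝ} (hγ : ∀ i, 0 < γ i)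
    {k : ℕ} (h : k ≤ d) : cumSum π γ k ≤ ∑ i, γ i :=
  cumSum_card π γ ▸ cumSum_mono π hγ h

theorem cumSum_eq_sum_map (π : Equiv.Perm (Fin d)) (v : Fin d → ℝ) (k : ℕ) :
    cumSum π v k =
      ∑ i ∈ (Finset.univ.filter fun j : Fin d => j.val < k).map π.symm.toEmbedding, v i := by
  rw [Finset.sum_map]; rfl

/-- A sum of consecutive increments over the levels, read in the order `π`, telescopes. -/
theorem sum_increments (π : Equiv.Perm (Fin d)) (F : ℕ → ℝ) :
    ∑ i, (F ((π i).val + 1) - F (π i).val) = F d - F 0 := by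
  rw [Equiv.sum_comp π fun k : Fin d => F (k.val + 1) - F k.val,
    Fin.sum_univ_eq_sum_range (fun k => F (k + 1) - F k) d, Finset.sum_range_sub]

/-- The fraction of the segment of index `k` of the curve with order `π` that lies to the left
of `x`. -/
noncomputable def segmentFraction (γ : Fin d → ℝ) (π : Equiv.Perm (Fin d)) (k : Fin d) (x : ℝ) :
    ℝ :=
  max 0 (min 1 ((x - cumSum π γ k.val) / γ (π.symm k)))

theorem piecewiseCurve_eq_sum (γ p : Fin d → ℝ) (π : Equiv.Perm (Fin d)) (x : ℝ) :
    piecewiseCurve γ p π x = ∑ k, p (π.symm k) * segmentFraction γ π k x := rfl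

theorem segmentFraction_mono {γ : Fin d → ℝ} (hγ : ∀ i, 0 < γ i) (π : Equiv.Perm (Fin d))
    (k : Fin d) : Monotone (segmentFraction γ π k) := by
  intro x y h
  have := hγ (π.symm k)
  unfold segmentFraction
  gcongr

theorem segmentFraction_eq_zero {γ : Fin d → ℝ} (hγ : ∀ i, 0 < γ i) (π : Equiv.Perm (Fin d))
    {k : Fin d} {x : ℝ} (h : x ≤ cumSum π γ k.val) : segmentFraction γ π k x = 0 :=
  max_eq_left ((min_le_right _ _).trans
    (div_nonpos_of_nonpos_of_nonneg (by linarith) (hγ _).le))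

theorem segmentFraction_eq_one {γ : Fin d → ℝ} (hγ : ∀ i, 0 < γ i) (π : Equiv.Perm (Fin d))
    {k : Fin d} {x : ℝ} (h : cumSum π γ (k.val + 1) ≤ x) : segmentFraction γ π k x = 1 := by
  rw [cumSum_succ] at h
  have : 1 ≤ (x - cumSum π γ k.val) / γ (π.symm k) := by
    rw [le_div_iff₀ (hγ _)]; linarith
  simp [segmentFraction, min_eq_left this]

/-- The widths of the parts of the segments to the left of `x` add up to `x`. -/
theorem sum_mul_segmentFraction {γ : Fin d → ℝ} (hγ : ∀ i, 0 < γ i) (π : Equiv.Perm (Fin d))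
    {x : ℝ} (h0 : 0 ≤ x) (h1 : x ≤ ∑ i, γ i) :
    ∑ k, γ (π.symm k) * segmentFraction γ π k x = x := by
  -- Each term is the length of the part of segment `k` left of `x`; written with `min`, the sum
  -- telescopes.
  have key : ∀ k : Fin d, γ (π.symm k) * segmentFraction γ π k x
      = min x (cumSum π γ (k.val + 1)) - min x (cumSum π γ k.val) := by
    intro k
    have hk := hγ (π.symm k)
    have hs := cumSum_succ π γ k
    rcases le_total x (cumSum π γ k.val) with h | h
    · rw [segmentFraction_eq_zero hγ π h, min_eq_left h, min_eq_left (by linarith)]; ring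
    rcases le_total (cumSum π γ (k.val + 1)) x with h' | h'
    · rw [segmentFraction_eq_one hγ π h', min_eq_right h, min_eq_right h', hs]; ring
    · have h2 : (x - cumSum π γ k.val) / γ (π.symm k) ≤ 1 := by
        rw [div_le_one hk]; linarith
      have h3 : 0 ≤ (x - cumSum π γ k.val) / γ (π.symm k) := div_nonneg (by linarith) hk.le
      rw [segmentFraction, min_eq_right h2, max_eq_right h3, min_eq_right h, min_eq_left h']
      field_simp
  rw [Finset.sum_congr rfl fun k _ => key k,
    Fin.sum_univ_eq_sum_range (fun k => min x (cumSum π γ (k + 1)) - min x (cumSum π γ k)) d,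
    Finset.sum_range_sub fun k => min x (cumSum π γ k), cumSum_card, cumSum_zero,
    min_eq_left h1, min_eq_right h0, sub_zero]

theorem thermoCurve_zero {γ : Fin d → ℝ} (hγ : ∀ i, 0 < γ i) (p : Fin d → ℝ) :
    thermoCurve γ p 0 = 0 := by
  rw [thermoCurve, piecewiseCurve_eq_sum]
  refine Finset.sum_eq_zero fun k _ => ?_
  rw [segmentFraction_eq_zero hγ, mul_zero]
  exact cumSum_zero (betaOrder γ p) γ ▸ cumSum_mono _ hγ (Nat.zero_le _)

theorem thermoCurve_sum {γ : Fin d → ℝ} (hγ : ∀ i, 0 < γ i) (p : Fin d → ℝ) :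
    thermoCurve γ p (∑ i, γ i) = ∑ i, p i := by
  rw [thermoCurve, piecewiseCurve_eq_sum, ← Equiv.sum_comp (betaOrder γ p).symm p]
  refine Finset.sum_congr rfl fun k _ => ?_
  rw [segmentFraction_eq_one hγ _ (cumSum_le_sum _ hγ k.isLt), mul_one]

/-- Among all weights in `[0, 1]` with `γ`-mass `x`, the thermomajorisation curve realises the
largest `p`-mass. -/
theorem sum_mul_le_thermoCurve {γ p : Fin d → ℝ} (hγ : ∀ i, 0 < γ i) (hp : ∀ i, 0 ≤ p i)
    {t : Fin d → ℝ} (ht0 : ∀ i, 0 ≤ t i) (ht1 : ∀ i, t i ≤ 1) :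
    ∑ i, t i * p i ≤ thermoCurve γ p (∑ i, t i * γ i) := by
  set x := ∑ i, t i * γ i with hx
  set σ := betaOrder γ p with hσ
  have hx0 : 0 ≤ x := Finset.sum_nonneg fun i _ => mul_nonneg (ht0 i) (hγ i).le
  have hx1 : x ≤ ∑ i, γ i :=
    Finset.sum_le_sum fun i _ => mul_le_of_le_one_left (hγ i).le (ht1 i)
  -- Here `r` is the slope of the first segment not completely filled: earlier ones are full with
  -- ratio at least `r`, later ones empty with ratio at most `r`. If all are full, `r = 0` works
  -- because `p` is nonnegative.
  obtain ⟨r, hr⟩ : ∃ r : ℝ, ∀ k, 0 ≤ (segmentFraction γ σ k x - t (σ.symm k)) *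
      (p (σ.symm k) - r * γ (σ.symm k)) := by
    by_cases hall : ∀ k, segmentFraction γ σ k x = 1
    · refine ⟨0, fun k => ?_⟩
      rw [hall, zero_mul, sub_zero]
      exact mul_nonneg (sub_nonneg.2 (ht1 _)) (hp _)
    · push Not at hall
      obtain ⟨m, hm, hmin⟩ := WellFounded.has_min (wellFounded_lt (α := Fin d))
        {k | segmentFraction γ σ k x ≠ 1} hall
      have ratio : ∀ k l : Fin d, k ≤ l →
          p (σ.symm l) / γ (σ.symm l) ≤ p (σ.symm k) / γ (σ.symm k) :=
        fun k l h => betaOrder_antitone γ p h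
      refine ⟨p (σ.symm m) / γ (σ.symm m), fun k => ?_⟩
      rcases lt_trichotomy k m with h | h | h
      · have h1 : segmentFraction γ σ k x = 1 := by
          by_contra hne; exact hmin k hne h
        rw [h1]
        refine mul_nonneg (sub_nonneg.2 (ht1 _)) (sub_nonneg.2 ?_)
        exact (le_div_iff₀ (hγ _)).1 (ratio _ _ h.le)
      · subst h
        rw [div_mul_cancel₀ _ (hγ _).ne', sub_self, mul_zero]
      · have hlt : x ≤ cumSum σ γ k.val := by
          by_contra hcon
          push Not at hcon
          exact hm (segmentFraction_eq_one hγ σ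
            ((cumSum_mono σ hγ (Nat.succ_le_of_lt h)).trans hcon.le))
        rw [segmentFraction_eq_zero hγ σ hlt, zero_sub]
        refine mul_nonneg_of_nonpos_of_nonpos (neg_nonpos.2 (ht0 _)) (sub_nonpos.2 ?_)
        exact (div_le_iff₀ (hγ _)).1 (ratio _ _ h.le)
  have hsum := Finset.sum_nonneg fun k (_ : k ∈ Finset.univ) => hr k
  -- Both weightings have `γ`-mass `x`, so the term with `r` will vanish.
  have expand : ∑ k, (segmentFraction γ σ k x - t (σ.symm k)) *
      (p (σ.symm k) - r * γ (σ.symm k)) =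
      (∑ k, p (σ.symm k) * segmentFraction γ σ k x - ∑ k, t (σ.symm k) * p (σ.symm k)) -
      r * (∑ k, γ (σ.symm k) * segmentFraction γ σ k x
        - ∑ k, t (σ.symm k) * γ (σ.symm k)) := by
    rw [← Finset.sum_sub_distrib, ← Finset.sum_sub_distrib, Finset.mul_sum,
      ← Finset.sum_sub_distrib]
    exact Finset.sum_congr rfl fun k _ => by ring
  rw [expand, sum_mul_segmentFraction hγ σ hx0 hx1,
    Equiv.sum_comp σ.symm fun i => t i * p i, Equiv.sum_comp σ.symm fun i => t i * γ i, ← hx,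
    sub_self, mul_zero, sub_zero] at hsum
  exact sub_nonneg.1 hsum

/-- Thermomajorisation: the partial sums of a thermally reachable state lie below the curve. -/
theorem sum_mulVec_le_thermoCurve {γ p : Fin d → ℝ} (hγ : ∀ i, 0 < γ i) (hp : ∀ i, 0 ≤ p i)
    {Λ : Matrix (Fin d) (Fin d) ℝ} (hΛ : IsGibbsPreserving γ Λ) (I : Finset (Fin d)) :
    ∑ i ∈ I, Λ.mulVec p i ≤ thermoCurve γ p (∑ i ∈ I, γ i) := by
  have swap : ∀ v : Fin d → ℝ, ∑ i ∈ I, Λ.mulVec v i = ∑ j, (∑ i ∈ I, Λ i j) * v j := by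
    intro v
    simp only [Matrix.mulVec, dotProduct, Finset.sum_mul]
    exact Finset.sum_comm
  have hγI : ∑ i ∈ I, γ i = ∑ j, (∑ i ∈ I, Λ i j) * γ j := by rw [← swap, hΛ.2]
  have hcol := Matrix.mem_colStochastic_iff_sum.1 hΛ.1
  rw [swap, hγI]
  -- The weight of level `j` is the part of column `j` lying in `I`, at most the full column sum
  -- `1`.
  refine sum_mul_le_thermoCurve hγ hp (fun j => Finset.sum_nonneg fun i _ => hcol.1 i j)
    fun j => ?_
  rw [← hcol.2 j]
  exact Finset.sum_le_univ_sum_of_nonneg fun i => hcol.1 i j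

/-! ### The hull lies in the cone. -/

theorem convex_futureThermalCone (γ p : Fin d → ℝ) : Convex ℝ (futureThermalCone γ p) := by
  rintro _ ⟨A, hA, rfl⟩ _ ⟨B, hB, rfl⟩ a b ha hb hab
  refine ⟨a • A + b • B, ⟨Matrix.convex_colStochastic hA.1 hB.1 ha hb hab, ?_⟩, ?_⟩
  · rw [Matrix.add_mulVec, Matrix.smul_mulVec, Matrix.smul_mulVec, hA.2, hB.2, ← add_smul, hab,
      one_smul]
  · rw [Matrix.add_mulVec, Matrix.smul_mulVec, Matrix.smul_mulVec]

/-- Lay intervals of lengths `γ` end to end, once in the `β`-order and once in the order `π`. The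
entry `Λ i l` is the fraction of the first interval of `l` covered by the second interval of `i`. -/
theorem orderedReading_mem_futureThermalCone {γ : Fin d → ℝ} (hγ : ∀ i, 0 < γ i)
    (p : Fin d → ℝ) (π : Equiv.Perm (Fin d)) :
    orderedReading γ p π ∈ futureThermalCone γ p := by
  set σ := betaOrder γ p with hσ
  let Λ : Matrix (Fin d) (Fin d) ℝ := fun i l =>
    segmentFraction γ σ (σ l) (cumSum π γ ((π i).val + 1)) -
      segmentFraction γ σ (σ l) (cumSum π γ (π i).val)
  have apply : ∀ (v : Fin d → ℝ) (i : Fin d), Λ.mulVec v i =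
      ∑ k, v (σ.symm k) * segmentFraction γ σ k (cumSum π γ ((π i).val + 1)) -
        ∑ k, v (σ.symm k) * segmentFraction γ σ k (cumSum π γ (π i).val) := by
    intro v i
    rw [Matrix.mulVec, dotProduct, ← Finset.sum_sub_distrib, ← Equiv.sum_comp σ.symm]
    refine Finset.sum_congr rfl fun k _ => ?_
    simp only [Λ, Equiv.apply_symm_apply]
    ring
  have nonneg : ∀ k, 0 ≤ cumSum π γ k := fun k =>
    cumSum_zero π γ ▸ cumSum_mono π hγ (Nat.zero_le k)
  refine ⟨Λ, ⟨Matrix.mem_colStochastic_iff_sum.2 ⟨fun i l => ?_, fun l => ?_⟩, ?_⟩, ?_⟩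
  · exact sub_nonneg.2 (segmentFraction_mono hγ σ _ (cumSum_mono π hγ (Nat.le_succ _)))
  · refine (sum_increments π fun m => segmentFraction γ σ (σ l) (cumSum π γ m)).trans ?_
    rw [cumSum_card, cumSum_zero, segmentFraction_eq_one hγ, segmentFraction_eq_zero hγ, sub_zero]
    · exact cumSum_zero σ γ ▸ cumSum_mono _ hγ (Nat.zero_le _)
    · exact cumSum_le_sum _ hγ (σ l).isLt
  · ext i
    rw [apply, sum_mul_segmentFraction hγ σ (nonneg _) (cumSum_le_sum π hγ (π i).isLt),
      sum_mul_segmentFraction hγ σ (nonneg _) (cumSum_le_sum π hγ (π i).isLt.le), cumSum_succ,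
      Equiv.symm_apply_apply]
    ring
  · ext i
    rw [apply]; rfl

/-- Abel summation for an antitone sequence of weights against a nonnegative sequence that
vanishes at both ends. -/
theorem sum_mul_increments_nonneg {v : Fin d → ℝ} (hv : Antitone v) {D : ℕ → ℝ}
    (hD : ∀ k, 0 ≤ D k) (h0 : D 0 = 0) (hd : D d = 0) :
    0 ≤ ∑ k : Fin d, v k * (D (k.val + 1) - D k.val) := by
  -- The boundary term is kept because `D` need not vanish at intermediate lengths of the induction.
  have bound : ∀ n (v : Fin (n + 1) → ℝ), Antitone v →
      v (Fin.last n) * D (n + 1) ≤ ∑ k : Fin (n + 1), v k * (D (k.val + 1) - D k.val) := by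
    intro n
    induction n with
    | zero => intro v _; simp [h0]
    | succ n ih =>
      intro v hv
      have h := ih (fun k => v k.castSucc) fun a b hab => hv (Fin.castSucc_le_castSucc_iff.2 hab)
      have hle : v (Fin.last (n + 1)) ≤ v (Fin.last n).castSucc := hv (Fin.le_last _)
      have hmul := mul_le_mul_of_nonneg_right hle (hD (n + 1))
      rw [Fin.sum_univ_castSucc]
      simp only [Fin.val_castSucc, Fin.val_last] at h ⊢
      linarith
  cases d with
  | zero => simp
  | succ n => simpa [hd] using bound n v hv

/-! ### The cone lies in the hull, by separation. -/

theorem futureThermalCone_subset_convexHull {γ p : Fin d → ℝ} (hγ : ∀ i, 0 < γ i)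
    (hp : ∀ i, 0 ≤ p i) :
    futureThermalCone γ p ⊆ convexHull ℝ (Set.range (orderedReading γ p)) := by
  rintro _ ⟨Λ, hΛ, rfl⟩
  set q := Λ.mulVec p with hq
  by_contra hmem
  obtain ⟨f, u, hfu, huq⟩ := geometric_hahn_banach_closed_point (convex_convexHull ℝ _)
    ((Set.finite_range (orderedReading γ p)).isClosed_convexHull ℝ) hmem
  set w : Fin d → ℝ := fun i => f (Pi.single i 1) with hw
  have hf : ∀ z, f z = ∑ i, w i * z i := fun z => by
    have := LinearMap.pi_apply_eq_sum_univ (f : (Fin d → ℝ) →ₗ[ℝ] ℝ) z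
    simp only [ContinuousLinearMap.coe_coe, smul_eq_mul] at this
    rw [this]
    refine Finset.sum_congr rfl fun i _ => ?_
    rw [mul_comm]
    congr 2
    ext j
    simp [Pi.single_apply, eq_comm]
  set π : Equiv.Perm (Fin d) := (Tuple.sort fun i => -w i).symm with hπ
  have hanti : Antitone fun k => w (π.symm k) := fun a b hab => by
    simpa [hπ] using Tuple.monotone_sort (fun i => -w i) hab
  set D : ℕ → ℝ := fun k => thermoCurve γ p (cumSum π γ k) - cumSum π q k with hDdef
  have hD : ∀ k, 0 ≤ D k := fun k => by
    simp only [hDdef, cumSum_eq_sum_map]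
    exact sub_nonneg.2 (sum_mulVec_le_thermoCurve hγ hp hΛ _)
  have hD0 : D 0 = 0 := by simp [hDdef, cumSum_zero, thermoCurve_zero hγ]
  have hDd : D d = 0 := by
    have hqsum : ∑ i, q i = ∑ i, p i := Matrix.sum_mulVec_of_mem_colStochastic hΛ.1
    simp [hDdef, cumSum_card, thermoCurve_sum hγ, hqsum]
  have habel := sum_mul_increments_nonneg hanti hD hD0 hDd
  have hdiff : ∑ k : Fin d, w (π.symm k) * (D (k.val + 1) - D k.val) =
      f (orderedReading γ p π) - f q := by
    rw [hf, hf, ← Finset.sum_sub_distrib,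
      ← Equiv.sum_comp π.symm fun i => w i * orderedReading γ p π i - w i * q i]
    refine Finset.sum_congr rfl fun k _ => ?_
    simp only [hDdef, orderedReading, Equiv.apply_symm_apply, cumSum_succ π q]
    ring
  have := hfu _ (subset_convexHull ℝ _ ⟨π, rfl⟩)
  linarith

theorem futureThermalCone_eq_convexHull {γ p : Fin d → ℝ} (hγ : ∀ i, 0 < γ i)
    (hp : ∀ i, 0 ≤ p i) :
    futureThermalCone γ p = convexHull ℝ (Set.range (orderedReading γ p)) := by
  refine (futureThermalCone_subset_convexHull hγ hp).antisymm
    (convexHull_min ?_ (convex_futureThermalCone γ p))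
  rintro _ ⟨π, rfl⟩
  exact orderedReading_mem_futureThermalCone hγ p π

/-! ### Projecting the embedded vector. -/

theorem sum_fin_increments (n : ℕ) (F : ℕ → ℝ) {a b : ℕ} (hab : a ≤ b) (hb : b ≤ n) :
    ∑ j : Fin n with a ≤ j.val ∧ j.val < b, (F (j.val + 1) - F j.val) = F b - F a := by
  rw [Finset.sum_filter, Fin.sum_univ_eq_sum_range
    (fun j => if a ≤ j ∧ j < b then F (j + 1) - F j else 0) n, ← Finset.sum_filter,
    ← Finset.sum_Ico_sub F hab]
  refine Finset.sum_congr ?_ fun _ _ => rfl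
  ext j
  simp only [Finset.mem_filter, Finset.mem_range, Finset.mem_Ico]
  omega

theorem projection_embedding {γ : Fin d → ℝ} (hγ : ∀ i, 0 < γ i) (p : Fin d → ℝ)
    (π : Equiv.Perm (Fin d)) :
    projection γ π (embedding γ p) = orderedReading γ p π := by
  ext l
  set a := elbowIndex γ π (π l).val with ha
  set b := elbowIndex γ π ((π l).val + 1) with hb
  have hΓa : partialSums γ a = cumSum π γ (π l).val := partialSums_elbowIndex γ π _
  have hΓb : partialSums γ b = cumSum π γ ((π l).val + 1) := partialSums_elbowIndex γ π _
  -- Positivity of `γ` separates the two partial sums strictly, so ties in the choice of indices do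
  -- no harm.
  have hab : a < b := by
    refine (partialSums_monotone γ).reflect_lt ?_
    rw [hΓa, hΓb, cumSum_succ]
    exact lt_add_of_pos_right _ (hγ _)
  -- The default `0` is never read: all indices used stay below `2 ^ d`.
  let F : ℕ → ℝ := fun j =>
    if h : j < 2 ^ d then thermoCurve γ p (partialSums γ ⟨j, h⟩) else 0
  have hF : ∀ k : Fin (2 ^ d), F k.val = thermoCurve γ p (partialSums γ k) := fun k => by
    simp [F]
  have hemb : ∀ j : Fin (2 ^ d - 1), embedding γ p j = F (j.val + 1) - F j.val := fun j => by
    have := j.isLt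
    simp only [embedding, F]
    rw [dif_pos (by omega), dif_pos (by omega)]
  have hbd := b.isLt
  change ∑ j : Fin (2 ^ d - 1) with a.val ≤ j.val ∧ j.val < b.val, embedding γ p j = _
  rw [Finset.sum_congr rfl fun j _ => hemb j,
    sum_fin_increments _ F (le_of_lt hab) (by omega), hF, hF, hΓa, hΓb]
  rfl

end

end ThermalCones

theorem mainTheorem7 {d : ℕ} (β : ℝ) (E : Fin d → ℝ) (p : Fin d → ℝ)
    (hp : p ∈ stdSimplex ℝ (Fin d)) :
    ThermalCones.futureThermalCone (ThermalCones.gibbs β E) p =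
      convexHull ℝ (Set.range fun π : Equiv.Perm (Fin d) =>
        ThermalCones.orderedReading (ThermalCones.gibbs β E) p π) ∧
    (∀ π : Equiv.Perm (Fin d),
      ThermalCones.projection (ThermalCones.gibbs β E) π
          (ThermalCones.embedding (ThermalCones.gibbs β E) p) =
        ThermalCones.orderedReading (ThermalCones.gibbs β E) p π) ∧
    ThermalCones.futureThermalCone (ThermalCones.gibbs β E) p =
      convexHull ℝ (Set.range fun π : Equiv.Perm (Fin d) =>
        ThermalCones.projection (ThermalCones.gibbs β E) π
          (ThermalCones.embedding (ThermalCones.gibbs β E) p)) := by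
  have hγ := ThermalCones.gibbs_pos β E
  have cone := ThermalCones.futureThermalCone_eq_convexHull hγ hp.1
  have proj := ThermalCones.projection_embedding hγ p
  exact ⟨cone, proj, by simpa only [proj] using cone⟩
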